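/- Let $\mathbb T=\{z\in\mathbb C:|z|=1\}$ be the circle group with normalized Lebesgue measure $m$. For a Borel probability measure $\mu$ on $\mathbb T$ and $1\le p\le\infty$, let $P_\mu$ be the operator $P_\mu f(x)=\int_{\mathbb T} f(xy)\,\mu(dy)$ on the complex space $L_p=L_p(\mathbb T,m)$, let $E$ be the operator $Ef=\int_{\mathbb T} f\,dm$ (a constant function), let $\|\cdot\|_p$ denote the operator norm on $L_p$, and let $\sigma(P_\mu,L_p)$ be the spectrum of $P_\mu$ on $L_p$. Proposition. There exists a probability measure $\mu$ on $\mathbb T$ such that 1. $\mu$ is continuous, i.e. $\mu(\{z\})=0$ for every $z\in\mathbb T$; 2. $\mu$ is supported on a Kronecker Cantor set, i.e. $\mu(\mathbb T\setminus C)=0$ for some nonempty compact, perfect, totally disconnected set $C\subset\mathbb T$ such that for every continuous $f:C\to\mathbb T$ and every $\varepsilon>0$ there is $n\in\mathbb Z$ with $|f(z)-z^n|<\varepsilon$ for all $z\in C$; 3. every convolution power $\mu^k=\mu*\cdots*\mu$, $k\ge1$, is singular with respect to $m$; 4. for every $1\le p\le\infty$ the limit $\lim_{n\to\infty}\|P_\mu^n-E\|_p$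 exists and is strictly positive; 5. $\sigma(P_\mu,L_1)=\sigma(P_\mu,L_2)=\{\lambda\in\mathbb C:|\lambda|\le1\}$. -/

import Mathlib

open MeasureTheory Filter Topology
open scoped ENNReal

noncomputable section

/-! The circle group `𝕋 = Circle` (complex numbers of modulus one), with its Borel field. -/

instance : MeasurableSpace Circle := borel Circle

instance : BorelSpace Circle := ⟨rfl⟩

instance : SecondCountableTopology Circle :=
  inferInstanceAs (SecondCountableTopology (Metric.sphere (0 : ℂ) 1))

/-- Normalized Lebesgue (Haar) measure on the circle. -/
def circleMeasure : Measure Circle := Measure.haarMeasure ⊤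

instance : IsProbabilityMeasure circleMeasure :=
  ⟨by simpa [circleMeasure] using Measure.haarMeasure_self (K₀ := (⊤ : TopologicalSpace.PositiveCompacts Circle))⟩

instance : circleMeasure.IsMulLeftInvariant := by
  unfold circleMeasure; infer_instance

instance : circleMeasure.IsMulRightInvariant :=
  ⟨fun g => by
    have h : (fun x : Circle => x * g) = fun x => g * x := funext fun x => mul_comm x g
    rw [h]
    exact map_mul_left_eq_self circleMeasure g⟩

/-- The convolution powers of a measure: `convPow μ 0 = δ₁`,
`convPow μ (k + 1) = convPow μ k ∗ μ`. -/
def convPow (μ : Measure Circle) : ℕ → Measure Circle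
  | 0 => Measure.dirac 1
  | k + 1 => (convPow μ k).mconv μ

section ConvolutionOperator

variable (μ : Measure Circle) [IsProbabilityMeasure μ]

/-- Multiplication carries the product of Lebesgue measure with `μ` to Lebesgue measure. -/
theorem measurePreserving_mul_circle :
    MeasurePreserving (fun z : Circle × Circle => z.1 * z.2)
      (circleMeasure.prod μ) circleMeasure := by
  refine ⟨measurable_mul, ?_⟩
  ext s hs
  rw [Measure.map_apply measurable_mul hs, Measure.prod_apply_symm (measurable_mul hs)]
  have : ∀ y : Circle, circleMeasure ((fun x => (x, y)) ⁻¹'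
      ((fun z : Circle × Circle => z.1 * z.2) ⁻¹' s)) = circleMeasure s := fun y =>
    measure_preimage_mul_right circleMeasure y s
  simp [this]

variable {μ}

/-- Averaging over the second variable is a contraction of `L_p`. -/
theorem eLpNorm_integral_prod_le {F : Circle × Circle → ℂ} {p : ℝ≥0∞} (hp : 1 ≤ p)
    (hF : AEStronglyMeasurable F (circleMeasure.prod μ)) :
    eLpNorm (fun x => ∫ y, F (x, y) ∂μ) p circleMeasure
      ≤ eLpNorm F p (circleMeasure.prod μ) := by
  have hsec : ∀ᵐ x ∂circleMeasure, AEStronglyMeasurable (fun y => F (x, y)) μ := hF.prodMk_left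
  by_cases htop : p = ∞
  · subst htop
    simp only [eLpNorm_exponent_top]
    have h1 : ∀ᵐ z ∂(circleMeasure.prod μ), ‖F z‖ₑ ≤ eLpNormEssSup F (circleMeasure.prod μ) :=
      enorm_ae_le_eLpNormEssSup F _
    have h2 := Measure.ae_ae_of_ae_prod h1
    refine essSup_le_of_ae_le _ ?_
    filter_upwards [h2] with x hx
    calc ‖∫ y, F (x, y) ∂μ‖ₑ ≤ ∫⁻ y, ‖F (x, y)‖ₑ ∂μ := enorm_integral_le_lintegral_enorm _
      _ ≤ ∫⁻ _, eLpNormEssSup F (circleMeasure.prod μ) ∂μ := lintegral_mono_ae hx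
      _ = _ := by simp
  · have hp0 : p ≠ 0 := (zero_lt_one.trans_le hp).ne'
    have hpos : 0 < p.toReal := ENNReal.toReal_pos hp0 htop
    rw [eLpNorm_eq_lintegral_rpow_enorm_toReal hp0 htop,
      eLpNorm_eq_lintegral_rpow_enorm_toReal hp0 htop]
    gcongr
    rw [lintegral_prod _ (hF.enorm.pow_const _)]
    refine lintegral_mono_ae ?_
    filter_upwards [hsec] with x hx
    have h1 : ‖∫ y, F (x, y) ∂μ‖ₑ ≤ eLpNorm (fun y => F (x, y)) p μ := by
      calc ‖∫ y, F (x, y) ∂μ‖ₑ ≤ ∫⁻ y, ‖F (x, y)‖ₑ ∂μ := enorm_integral_le_lintegral_enorm _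
        _ = eLpNorm (fun y => F (x, y)) 1 μ := by rw [eLpNorm_one_eq_lintegral_enorm]
        _ ≤ _ := eLpNorm_le_eLpNorm_of_exponent_le hp hx
    calc ‖∫ y, F (x, y) ∂μ‖ₑ ^ p.toReal ≤ (eLpNorm (fun y => F (x, y)) p μ) ^ p.toReal := by gcongr
      _ = _ := by
        rw [eLpNorm_eq_lintegral_rpow_enorm_toReal hp0 htop, ← ENNReal.rpow_mul,
          one_div, inv_mul_cancel₀ hpos.ne', ENNReal.rpow_one]

variable (μ)

theorem aestronglyMeasurable_comp_mul {f : Circle → ℂ}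
    (hf : AEStronglyMeasurable f circleMeasure) :
    AEStronglyMeasurable (fun z : Circle × Circle => f (z.1 * z.2)) (circleMeasure.prod μ) :=
  hf.comp_measurePreserving (measurePreserving_mul_circle μ)

theorem eLpNorm_conv_le {f : Circle → ℂ} {p : ℝ≥0∞} (hp : 1 ≤ p)
    (hf : AEStronglyMeasurable f circleMeasure) :
    eLpNorm (fun x => ∫ y, f (x * y) ∂μ) p circleMeasure ≤ eLpNorm f p circleMeasure :=
  (eLpNorm_integral_prod_le hp (aestronglyMeasurable_comp_mul μ hf)).trans_eq
    (eLpNorm_comp_measurePreserving hf (measurePreserving_mul_circle μ))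

theorem memLp_conv {f : Circle → ℂ} {p : ℝ≥0∞} (hp : 1 ≤ p) (hf : MemLp f p circleMeasure) :
    MemLp (fun x => ∫ y, f (x * y) ∂μ) p circleMeasure :=
  ⟨(aestronglyMeasurable_comp_mul μ hf.1).integral_prod_right',
    (eLpNorm_conv_le μ hp hf.1).trans_lt hf.2⟩

theorem conv_congr_ae {f g : Circle → ℂ} (h : f =ᵐ[circleMeasure] g) :
    (fun x => ∫ y, f (x * y) ∂μ) =ᵐ[circleMeasure] fun x => ∫ y, g (x * y) ∂μ := by
  have h1 := Measure.ae_ae_of_ae_prod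
    ((measurePreserving_mul_circle μ).quasiMeasurePreserving.ae_eq_comp h)
  filter_upwards [h1] with x hx
  exact integral_congr_ae hx

theorem ae_integrable_conv {f : Circle → ℂ} (hf : Integrable f circleMeasure) :
    ∀ᵐ x ∂circleMeasure, Integrable (fun y => f (x * y)) μ :=
  ((measurePreserving_mul_circle μ).integrable_comp_of_integrable hf).prod_right_ae

variable (p : ℝ≥0∞) [Fact (1 ≤ p)]

/-- The convolution operator `P_μ f (x) = ∫ f (x y) μ(dy)` on the complex space `L_p(𝕋, m)`. -/
def convOp : Lp ℂ p circleMeasure →L[ℂ] Lp ℂ p circleMeasure :=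
  LinearMap.mkContinuous
    { toFun := fun f => (memLp_conv μ Fact.out (Lp.memLp f)).toLp (fun x => ∫ y, f (x * y) ∂μ)
      map_add' := fun f g => by
        rw [← MemLp.toLp_add, MemLp.toLp_eq_toLp_iff]
        refine (conv_congr_ae μ (Lp.coeFn_add f g)).trans ?_
        filter_upwards [ae_integrable_conv μ ((Lp.memLp f).integrable Fact.out),
          ae_integrable_conv μ ((Lp.memLp g).integrable Fact.out)] with x hf hg
        exact integral_add hf hg
      map_smul' := fun c f => by
        rw [← MemLp.toLp_const_smul, MemLp.toLp_eq_toLp_iff]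
        refine (conv_congr_ae μ (Lp.coeFn_smul c f)).trans (Eventually.of_forall fun x => ?_)
        exact integral_smul c fun y => f (x * y) }
    1 fun f => by
      simp only [LinearMap.coe_mk, AddHom.coe_mk, one_mul, Lp.norm_toLp]
      exact ENNReal.toReal_mono (Lp.eLpNorm_ne_top f) (eLpNorm_conv_le μ Fact.out (Lp.memLp f).1)

/-- The expectation operator `E f = ∫ f dm` (a constant function) on `L_p(𝕋, m)`. -/
def meanOp : Lp ℂ p circleMeasure →L[ℂ] Lp ℂ p circleMeasure :=
  LinearMap.mkContinuous
    { toFun := fun f => Lp.const p circleMeasure (∫ x, f x ∂circleMeasure)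
      map_add' := fun f g => by
        rw [← map_add, integral_congr_ae (Lp.coeFn_add f g)]
        congr 1
        exact integral_add ((Lp.memLp f).integrable Fact.out) ((Lp.memLp g).integrable Fact.out)
      map_smul' := fun c f => by
        rw [integral_congr_ae (Lp.coeFn_smul c f)]
        exact (congrArg _ (integral_smul c f)).trans
          ((Lp.constₗ p circleMeasure ℂ).map_smul c (∫ x, f x ∂circleMeasure)) }
    1 fun f => by
      simp only [LinearMap.coe_mk, AddHom.coe_mk, one_mul]
      refine (Lp.norm_const_le _ _ _).trans ?_
      rw [measureReal_def, measure_univ, ENNReal.toReal_one, Real.one_rpow, mul_one]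
      have h1 : ‖∫ x, f x ∂circleMeasure‖ₑ ≤ eLpNorm f p circleMeasure := by
        calc ‖∫ x, f x ∂circleMeasure‖ₑ ≤ ∫⁻ x, ‖f x‖ₑ ∂circleMeasure :=
              enorm_integral_le_lintegral_enorm _
          _ = eLpNorm f 1 circleMeasure := by rw [eLpNorm_one_eq_lintegral_enorm]
          _ ≤ _ := eLpNorm_le_eLpNorm_of_exponent_le Fact.out (Lp.memLp f).1
      rw [Lp.norm_def, ← toReal_enorm]
      exact ENNReal.toReal_mono (Lp.eLpNorm_ne_top f) h1

end ConvolutionOperator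

/-- A Cantor set in the circle: nonempty, compact, totally disconnected and perfect. -/
def IsCantorSet (C : Set Circle) : Prop :=
  C.Nonempty ∧ IsCompact C ∧ IsTotallyDisconnected C ∧ Perfect C

/-- A Kronecker set in the circle: every continuous unimodular function on it is a uniform limit
of characters `z ↦ z ^ n`, `n ∈ ℤ`. -/
def IsKroneckerSet (C : Set Circle) : Prop :=
  ∀ f : Circle → ℂ, ContinuousOn f C → (∀ z ∈ C, ‖f z‖ = 1) →
    ∀ ε > 0, ∃ n : ℤ, ∀ z ∈ C, ‖f z - (z : ℂ) ^ n‖ < ε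

end

/-!
The measure is the image of fair coin tossing on the Cantor space `K = ℕ → Bool` under a
continuous map `φ : K → 𝕋` such that every continuous map `K → 𝕋` is a uniform limit of powers
`φ ^ n`, `n ∈ ℤ`.

Such a `φ` exists by Baire category (`exists_denseRange_zpow`). It suffices that for each nonempty
open `V ⊆ C(K, 𝕋)` the maps having some power in `V` are dense. Since `K` is totally disconnected,
continuous maps `K → 𝕋` have continuous logarithms of modulus at most `2π`, hence continuous
`n`-th roots that tend uniformly to `1`; so any map can be multiplied by a factor close to `1`
that makes its `n`-th power equal to a given element of `V`.

Density of the powers makes `φ` injective, so `C = φ(K)` is a Cantor set, and, read on `C`,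
it is the Kronecker property. All remaining claims follow from it.

* The coefficients `∫ z ^ n dμ` are dense in the closed unit disc
  (`closedBall_subset_closure_range_integral_zpow`): a point of the disc is the midpoint of `u, v`
  on the circle, hence the mean of a function on `K` equal to `u` and `v` on two halves, and this
  function is a uniform limit of powers of `φ`.
* The coefficients are eigenvalues of `P_μ` on every `L_p`, with the characters as eigenvectors.
  As `P_μ` is a contraction and spectra are closed, the spectrum is the disc. As there are
  coefficients with `n ≠ 0` of modulus close to `1`, and `E` kills these characters,
  `‖P_μ ^ n - E‖ ≥ 1` for all `n`; these norms decrease, so they converge.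
* Some `z ^ n` with `n ≠ 0` is uniformly close to `-1` on `C`, so the `k`-th convolution power is
  carried by a set where `z ^ n` is close to `(-1) ^ k`. Such sets have small Haar measure, so the
  convolution powers are singular (`IsKroneckerSet.convPow_mutuallySingular`).
-/

/-! ### Characters as eigenvectors of convolution operators -/

theorem Circle.continuous_coe_zpow (n : ℤ) : Continuous fun z : Circle => (z : ℂ) ^ n :=
  continuous_subtype_val.comp (continuous_zpow (G := Circle) n)

theorem Circle.norm_coe_zpow (n : ℤ) (z : Circle) : ‖(z : ℂ) ^ n‖ = 1 := by
  rw [norm_zpow, Circle.norm_coe, one_zpow]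

theorem Circle.memLp_coe_zpow (μ : Measure Circle) [IsFiniteMeasure μ] (p : ℝ≥0∞) (n : ℤ) :
    MemLp (fun z : Circle => (z : ℂ) ^ n) p μ :=
  MemLp.of_bound (Circle.continuous_coe_zpow n).aestronglyMeasurable 1
    (Eventually.of_forall fun z => (Circle.norm_coe_zpow n z).le)

/-- The character `z ↦ z ^ n` as an element of `L_p`. -/
noncomputable def lpChar (p : ℝ≥0∞) (n : ℤ) : Lp ℂ p circleMeasure :=
  (Circle.memLp_coe_zpow circleMeasure p n).toLp _

theorem lpChar_ne_zero (p : ℝ≥0∞) (n : ℤ) : lpChar p n ≠ 0 := by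
  intro h
  have h1 := (Circle.memLp_coe_zpow circleMeasure p n).coeFn_toLp
  change lpChar p n =ᵐ[circleMeasure] _ at h1
  rw [h] at h1
  obtain ⟨z, hz⟩ := (h1.symm.trans (Lp.coeFn_zero ℂ p circleMeasure)).exists
  exact zpow_ne_zero n (Circle.coe_ne_zero z) hz

instance : circleMeasure.IsHaarMeasure := by unfold circleMeasure; infer_instance

/-- The map `z ↦ z ^ n` is onto the circle for `n ≠ 0`, so it preserves Haar measure. -/
theorem measurePreserving_zpow_circle {n : ℤ} (hn : n ≠ 0) :
    MeasurePreserving (fun z : Circle => z ^ n) circleMeasure circleMeasure := by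
  refine (zpowGroupHom n).measurePreserving (μ := circleMeasure) (ν := circleMeasure)
    (continuous_zpow n) (fun z => ⟨Circle.exp (Complex.arg z / n), ?_⟩) rfl
  change Circle.exp (Complex.arg z / n) ^ n = z
  rw [← Circle.exp_intCast_mul, mul_div_cancel₀ _ (Int.cast_ne_zero.2 hn), Circle.exp_arg]

theorem integral_zpow_circle {n : ℤ} (hn : n ≠ 0) :
    ∫ z : Circle, (z : ℂ) ^ n ∂circleMeasure = 0 := by
  have h1 : ∫ z : Circle, (z : ℂ) ^ n ∂circleMeasure = ∫ z : Circle, (z : ℂ) ∂circleMeasure := by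
    have hm := measurePreserving_zpow_circle hn
    have hc : Continuous fun z : Circle => (z : ℂ) := continuous_subtype_val
    conv_rhs => rw [← hm.map_eq]
    rw [integral_map hm.measurable.aemeasurable (by rw [hm.map_eq]; exact hc.aestronglyMeasurable)]
    simp
  have h2 : ∫ z : Circle, (z : ℂ) ∂circleMeasure = -∫ z : Circle, (z : ℂ) ∂circleMeasure := by
    rw [← integral_neg]
    conv_lhs => rw [← integral_mul_left_eq_self _ (-1 : Circle)]
    simp
  rw [h1]
  exact self_eq_neg.1 h2

section Coefficients

variable (μ : Measure Circle) [IsProbabilityMeasure μ] (p : ℝ≥0∞) [Fact (1 ≤ p)]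

theorem convOp_lpChar (n : ℤ) :
    convOp μ p (lpChar p n) = (∫ y : Circle, (y : ℂ) ^ n ∂μ) • lpChar p n := by
  change (memLp_conv μ Fact.out (Lp.memLp (lpChar p n))).toLp _ = _
  rw [lpChar, ← MemLp.toLp_const_smul, MemLp.toLp_eq_toLp_iff]
  refine (conv_congr_ae μ (MemLp.coeFn_toLp _)).trans (Eventually.of_forall fun x => ?_)
  simp only [Circle.coe_mul, mul_zpow, integral_const_mul, Pi.smul_apply, smul_eq_mul]
  exact mul_comm _ _

theorem meanOp_lpChar {n : ℤ} (hn : n ≠ 0) : meanOp p (lpChar p n) = 0 := by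
  change Lp.const p circleMeasure (∫ x, lpChar p n x ∂circleMeasure) = 0
  rw [lpChar, integral_congr_ae (MemLp.coeFn_toLp _), integral_zpow_circle hn, map_zero]

theorem convOp_comp_meanOp : convOp μ p * meanOp p = meanOp p := by
  ext1 f
  change convOp μ p (Lp.const p circleMeasure (∫ x, f x ∂circleMeasure)) =
    Lp.const p circleMeasure (∫ x, f x ∂circleMeasure)
  generalize ∫ x, f x ∂circleMeasure = c
  change (memLp_conv μ Fact.out (Lp.memLp (Lp.const p circleMeasure c))).toLp _ =
    (memLp_const c).toLp _
  rw [MemLp.toLp_eq_toLp_iff]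
  refine (conv_congr_ae μ (Lp.coeFn_const p circleMeasure c)).trans
    (Eventually.of_forall fun x => ?_)
  simp

theorem norm_convOp_le_one : ‖convOp μ p‖ ≤ 1 :=
  LinearMap.mkContinuous_norm_le _ zero_le_one _

theorem convOp_pow_lpChar (k : ℕ) (n : ℤ) :
    (convOp μ p ^ k) (lpChar p n) = (∫ y : Circle, (y : ℂ) ^ n ∂μ) ^ k • lpChar p n := by
  induction k with
  | zero => simp
  | succ k ih =>
    rw [pow_succ, mul_apply_eq_comp, convOp_lpChar, map_smul, ih, smul_smul,
      pow_succ, mul_comm]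

theorem norm_integral_zpow_pow_le (k : ℕ) {n : ℤ} (hn : n ≠ 0) :
    ‖∫ y : Circle, (y : ℂ) ^ n ∂μ‖ ^ k ≤ ‖convOp μ p ^ k - meanOp p‖ := by
  have h := (convOp μ p ^ k - meanOp p).le_opNorm (lpChar p n)
  rw [sub_apply, meanOp_lpChar p hn, sub_zero, convOp_pow_lpChar, norm_smul,
    norm_pow] at h
  exact le_of_mul_le_mul_right h (norm_pos_iff.2 (lpChar_ne_zero p n))

/-- `‖P ^ n - E‖` is antitone because `P ^ (n + 1) - E = P (P ^ n - E)` and `P` is a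
contraction. -/
theorem antitone_norm_convOp_pow_sub : Antitone fun n : ℕ => ‖convOp μ p ^ n - meanOp p‖ := by
  refine antitone_nat_of_succ_le fun n => ?_
  have h : convOp μ p ^ (n + 1) - meanOp p = convOp μ p * (convOp μ p ^ n - meanOp p) := by
    rw [mul_sub, convOp_comp_meanOp, pow_succ']
  rw [h]
  exact (norm_mul_le _ _).trans
    (mul_le_of_le_one_left (norm_nonneg _) (norm_convOp_le_one μ p))

theorem integral_zpow_mem_spectrum (n : ℤ) :
    ∫ y : Circle, (y : ℂ) ^ n ∂μ ∈ spectrum ℂ (convOp μ p) := by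
  rw [spectrum.mem_iff]
  rintro ⟨u, hu⟩
  refine lpChar_ne_zero p n ?_
  have h0 : (u : Lp ℂ p circleMeasure →L[ℂ] Lp ℂ p circleMeasure) (lpChar p n) = 0 := by
    rw [hu, sub_apply, convOp_lpChar, ContinuousLinearMap.algebraMap_apply,
      sub_self]
  have h1 := congrArg (fun T => T (lpChar p n)) u.inv_mul
  simpa only [mul_apply_eq_comp, h0, map_zero, one_apply_eq_self]
    using h1.symm

theorem spectrum_convOp_subset : spectrum ℂ (convOp μ p) ⊆ Metric.closedBall 0 1 := by
  intro c hc
  rw [mem_closedBall_zero_iff]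
  exact (spectrum.norm_le_norm_mul_of_mem hc).trans
    (mul_le_one₀ (norm_convOp_le_one μ p) (norm_nonneg _) ContinuousLinearMap.norm_id_le)

/-- If the Fourier-Stieltjes coefficients of `μ` are dense in the unit disc, the spectrum is the
disc: each coefficient is an eigenvalue, and the spectrum is closed. -/
theorem spectrum_convOp_eq_closedBall
    (hμ : Metric.closedBall 0 1 ⊆ closure (Set.range fun n : ℤ => ∫ y : Circle, (y : ℂ) ^ n ∂μ)) :
    spectrum ℂ (convOp μ p) = Metric.closedBall 0 1 :=
  (spectrum_convOp_subset μ p).antisymm <| hμ.trans <|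
    (spectrum.isClosed _).closure_subset_iff.2 <|
      Set.range_subset_iff.2 (integral_zpow_mem_spectrum μ p)

/-- If the Fourier-Stieltjes coefficients of `μ` approach `-1`, then no power of the convolution
operator comes closer to the mean than distance `1`. -/
theorem one_le_norm_convOp_pow_sub
    (hμ : (-1 : ℂ) ∈ closure (Set.range fun n : ℤ => ∫ y : Circle, (y : ℂ) ^ n ∂μ)) (k : ℕ) :
    1 ≤ ‖convOp μ p ^ k - meanOp p‖ := by
  refine le_of_forall_lt fun a ha => ?_
  -- The value `-1`, rather than `1`, keeps the trivial character `n = 0` away.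
  have hU : {w : ℂ | w ≠ 1 ∧ a < ‖w‖ ^ k} ∈ 𝓝 (-1 : ℂ) := by
    refine (IsOpen.inter isOpen_ne
      (isOpen_lt continuous_const (continuous_norm.pow k))).mem_nhds ⟨?_, ?_⟩
    · simp only [Set.mem_ofPred_eq]; norm_num
    · simpa using ha
  obtain ⟨w, ⟨hw1, hw2⟩, n, rfl⟩ := mem_closure_iff_nhds.1 hμ _ hU
  refine hw2.trans_le (norm_integral_zpow_pow_le μ p k ?_)
  rintro rfl
  simp at hw1

theorem exists_tendsto_norm_convOp_pow_sub
    (hμ : (-1 : ℂ) ∈ closure (Set.range fun n : ℤ => ∫ y : Circle, (y : ℂ) ^ n ∂μ)) :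
    ∃ c : ℝ, 0 < c ∧ Tendsto (fun n : ℕ => ‖convOp μ p ^ n - meanOp p‖) atTop (𝓝 c) := by
  have hlim := tendsto_atTop_ciInf (antitone_norm_convOp_pow_sub μ p)
    ⟨0, Set.forall_mem_range.2 fun _ => norm_nonneg _⟩
  exact ⟨_, zero_lt_one.trans_le
    (ge_of_tendsto' hlim (one_le_norm_convOp_pow_sub μ p hμ)), hlim⟩

end Coefficients

/-! ### Singularity of the convolution powers -/

instance (μ : Measure Circle) [IsProbabilityMeasure μ] (k : ℕ) :
    IsProbabilityMeasure (convPow μ k) := by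
  induction k with
  | zero => exact Measure.dirac.isProbabilityMeasure
  | succ k ih => rw [convPow]; infer_instance

/-- If `z ^ n` is within `δ` of `-1` on the support of `μ`, then it is within `k δ` of `(-1) ^ k`
on the support of the `k`-th convolution power. -/
theorem ae_convPow_norm_zpow_sub_le {μ : Measure Circle} [IsProbabilityMeasure μ] {n : ℤ} {δ : ℝ}
    (h : ∀ᵐ z : Circle ∂μ, ‖(z : ℂ) ^ n - (-1)‖ ≤ δ) (k : ℕ) :
    ∀ᵐ z : Circle ∂convPow μ k, ‖(z : ℂ) ^ n - (-1) ^ k‖ ≤ k * δ := by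
  have hmeas : ∀ (a : ℂ) (r : ℝ), MeasurableSet {z : Circle | ‖(z : ℂ) ^ n - a‖ ≤ r} := fun a r =>
    (isClosed_le (((Circle.continuous_coe_zpow n).sub continuous_const).norm)
      continuous_const).measurableSet
  induction k with
  | zero =>
    rw [convPow, ae_dirac_iff (hmeas _ _)]
    simp
  | succ k ih =>
    rw [convPow, Measure.mconv, ae_map_iff measurable_mul.aemeasurable (hmeas _ _)]
    filter_upwards [Measure.quasiMeasurePreserving_fst.ae ih,
      Measure.quasiMeasurePreserving_snd.ae h] with z h1 h2
    have hsplit : ((z.1 * z.2 : Circle) : ℂ) ^ n - (-1) ^ (k + 1) =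
        ((z.1 : ℂ) ^ n - (-1) ^ k) * (z.2 : ℂ) ^ n + (-1) ^ k * ((z.2 : ℂ) ^ n - (-1)) := by
      rw [Circle.coe_mul, mul_zpow]
      ring
    rw [hsplit]
    refine (norm_add_le _ _).trans ?_
    rw [norm_mul, norm_mul, Circle.norm_coe_zpow]
    simp only [norm_pow, norm_neg, norm_one, one_pow, mul_one, one_mul]
    push_cast
    linarith

instance : Nontrivial Circle := ⟨⟨-1, 1, Circle.neg_ne_self 1⟩⟩

/-- The convolution powers of a probability measure concentrated on a Kronecker set `C` are
singular. Some `z ^ n` is uniformly close to `-1` on `C`; then `n ≠ 0`, and the `k`-th convolution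
power lives on the set where `z ^ n` is close to `(-1) ^ k`. Since `z ↦ z ^ n` preserves Haar
measure, this set has Haar measure close to that of a point. -/
theorem IsKroneckerSet.convPow_mutuallySingular {C : Set Circle} (hC : IsKroneckerSet C)
    {μ : Measure Circle} [IsProbabilityMeasure μ] (hμ : μ Cᶜ = 0) (k : ℕ) :
    (convPow μ k).MutuallySingular circleMeasure := by
  have hδ : ∀ j : ℕ, ∃ n : ℤ, n ≠ 0 ∧ ∀ᵐ z : Circle ∂μ, ‖(z : ℂ) ^ n - (-1)‖ ≤ 1 / ((j : ℝ) + 1) := by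
    intro j
    obtain ⟨n, hn⟩ := hC (fun _ => -1) continuousOn_const (by simp) (1 / ((j : ℝ) + 1))
      Nat.one_div_pos_of_nat
    have hae : ∀ᵐ z : Circle ∂μ, ‖(z : ℂ) ^ n - (-1)‖ ≤ 1 / ((j : ℝ) + 1) := by
      filter_upwards [mem_ae_iff.2 hμ] with z hz
      rw [norm_sub_rev]
      exact (hn z hz).le
    refine ⟨n, ?_, hae⟩
    rintro rfl
    obtain ⟨z, hz⟩ := hae.exists
    have h1 : 1 / ((j : ℝ) + 1) ≤ 1 := by
      rw [div_le_one (by positivity)]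
      linarith [Nat.cast_nonneg (α := ℝ) j]
    norm_num at hz h1
    linarith
  choose n hn hae using hδ
  let A : ℕ → Set Circle := fun j => {z | ‖(z : ℂ) - (-1) ^ k‖ ≤ k * (1 / ((j : ℝ) + 1))}
  have hAc : ∀ j, IsClosed (A j) := fun j => isClosed_le
    ((continuous_subtype_val.sub continuous_const).norm) continuous_const
  have hanti : Antitone A := by
    intro i j hij z hz
    refine le_trans (b := (k : ℝ) * (1 / ((j : ℝ) + 1))) hz ?_
    gcongr
  have hlim : Tendsto (fun j => circleMeasure (A j)) atTop (𝓝 0) := by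
    have hsub : ⋂ j, A j ⊆ {(-1) ^ k} := by
      intro z hz
      have h0 : Tendsto (fun j : ℕ => k * (1 / ((j : ℝ) + 1))) atTop (𝓝 0) := by
        simpa using tendsto_one_div_add_atTop_nhds_zero_nat.const_mul (k : ℝ)
      have h1 : ‖(z : ℂ) - (-1) ^ k‖ ≤ 0 := ge_of_tendsto' h0 (Set.mem_iInter.1 hz)
      rw [Set.mem_singleton_iff]
      ext
      simpa using sub_eq_zero.1 (norm_le_zero_iff.1 h1)
    have : NullSingletonClass circleMeasure := inferInstance
    have h0 : circleMeasure (⋂ j, A j) = 0 := measure_mono_null hsub (measure_singleton _)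
    rw [← h0]
    exact tendsto_measure_iInter_atTop (fun j => (hAc j).measurableSet.nullMeasurableSet) hanti
      ⟨0, measure_ne_top _ _⟩
  let B : ℕ → Set Circle := fun j => (fun z : Circle => z ^ n j) ⁻¹' A j
  have hB : ∀ j, MeasurableSet (B j) := fun j =>
    ((hAc j).preimage (continuous_zpow (n j))).measurableSet
  have hconv : ∀ j, convPow μ k (B j)ᶜ = 0 := fun j => ae_convPow_norm_zpow_sub_le (hae j) k
  refine Measure.MutuallySingular.symm ⟨⋂ j, B j, MeasurableSet.iInter hB, ?_, ?_⟩
  · refine le_antisymm (ge_of_tendsto' hlim fun j => ?_) zero_le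
    rw [← (measurePreserving_zpow_circle (hn j)).measure_preimage
      (hAc j).measurableSet.nullMeasurableSet]
    exact measure_mono (Set.iInter_subset B j)
  · rw [Set.compl_iInter]
    exact measure_iUnion_null hconv

/-! ### A continuous map whose powers are dense -/

/-- On a compact totally disconnected space every continuous circle-valued function has a
continuous real logarithm: a clopen set separates the fibre over `-1`, where the principal
argument jumps, from the fibre over `1`, where the argument of the negative jumps. -/
theorem ContinuousMap.exists_circleExp_eq {K : Type*} [TopologicalSpace K] [CompactSpace K]
    [T2Space K] [TotallyDisconnectedSpace K] (g : C(K, Circle)) :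
    ∃ θ : C(K, ℝ), (∀ k, Circle.exp (θ k) = g k) ∧ ∀ k, |θ k| ≤ 2 * Real.pi := by
  classical
  obtain ⟨D, hD, h1, h2⟩ := exists_clopen_of_closed_subset_open
    (Z := g ⁻¹' {-1}) (U := g ⁻¹' {1}ᶜ) (isClosed_singleton.preimage g.continuous)
    (isOpen_compl_singleton.preimage g.continuous) (by
      intro k hk
      simp only [Set.mem_preimage, Set.mem_singleton_iff, Set.mem_compl_iff] at hk ⊢
      rw [hk]; exact Circle.neg_ne_self 1)
  have slit : ∀ z : Circle, z ≠ -1 → (z : ℂ) ∈ Complex.slitPlane := by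
    intro z hz
    by_contra hn
    rw [Complex.mem_slitPlane_iff_arg, not_and_or] at hn
    rcases hn with hn | hn
    · refine hz ?_
      rw [not_not] at hn
      rw [← Circle.exp_arg z, hn]
      ext
      simp
    · exact hn (Circle.coe_ne_zero z)
  have hco : Continuous (fun z : Circle => (z : ℂ)) := continuous_subtype_val
  have hcont : Continuous (D.piecewise (fun k => Complex.arg ((-(g k) : Circle) : ℂ) + Real.pi)
      (fun k => Complex.arg (g k : ℂ))) := by
    refine continuous_piecewise (by simp [hD.frontier_eq]) ?_ ?_
    · rw [hD.1.closure_eq]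
      refine ContinuousOn.add (fun k hk => ContinuousAt.continuousWithinAt ?_) continuousOn_const
      have hne : -(g k) ≠ -1 := fun h => h2 hk (by simpa using h)
      exact (Complex.continuousAt_arg (slit _ hne)).comp
        (f := fun k => ((-(g k) : Circle) : ℂ))
        (hco.comp (continuous_neg.comp g.continuous)).continuousAt
    · rw [hD.compl.1.closure_eq]
      intro k hk
      refine ContinuousAt.continuousWithinAt ?_
      have hne : g k ≠ -1 := fun h => hk (h1 h)
      exact (Complex.continuousAt_arg (slit _ hne)).comp
        (f := fun k => (g k : ℂ)) (hco.comp g.continuous).continuousAt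
  refine ⟨⟨_, hcont⟩, fun k => ?_, fun k => ?_⟩
  · by_cases hk : k ∈ D
    · have hpi : Circle.exp Real.pi = -1 := by ext; simp
      simp only [ContinuousMap.coe_mk, Set.piecewise_eq_of_mem _ _ _ hk, Circle.exp_add,
        Circle.exp_arg, hpi]
      simp
    · simp only [ContinuousMap.coe_mk, Set.piecewise_eq_of_notMem _ _ _ hk, Circle.exp_arg]
  · have hpi := Real.pi_pos
    by_cases hk : k ∈ D
    · simp only [ContinuousMap.coe_mk, Set.piecewise_eq_of_mem _ _ _ hk]
      have := abs_le.1 (Complex.abs_arg_le_pi ((-(g k) : Circle) : ℂ))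
      rw [abs_le]; constructor <;> linarith
    · simp only [ContinuousMap.coe_mk, Set.piecewise_eq_of_notMem _ _ _ hk]
      exact (Complex.abs_arg_le_pi _).trans (by linarith)

theorem Circle.dist_exp_one_le (t : ℝ) : dist (Circle.exp t) 1 ≤ |t| := by
  have h : dist (Circle.exp t) 1 = ‖Complex.exp (t * Complex.I) - 1‖ := by
    rw [← Circle.coe_exp, ← Circle.coe_one, ← dist_eq_norm]
    rfl
  rw [h, mul_comm]
  exact Real.norm_exp_I_mul_ofReal_sub_one_le

/-- High-order roots of a continuous circle-valued function can be chosen continuous and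
uniformly close to `1`. -/
theorem ContinuousMap.exists_roots_tendsto_one {K : Type*} [TopologicalSpace K] [CompactSpace K]
    [T2Space K] [TotallyDisconnectedSpace K] (g : ℕ → C(K, Circle)) :
    ∃ h : ℕ → C(K, Circle), (∀ n, h n ^ (n + 1) = g n) ∧ Tendsto h atTop (𝓝 1) := by
  choose θ hθ hb using fun n => (g n).exists_circleExp_eq
  refine ⟨fun n => ⟨fun k => Circle.exp (θ n k / (n + 1 : ℕ)), by fun_prop⟩, fun n => ?_, ?_⟩
  · ext k
    simp only [ContinuousMap.pow_apply, ContinuousMap.coe_mk]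
    rw [← Circle.exp_natCast_mul, mul_div_cancel₀ _ (by positivity), hθ]
  · rw [tendsto_iff_dist_tendsto_zero]
    have h0 : Tendsto (fun n : ℕ => (2 * Real.pi) / ((n : ℝ) + 1)) atTop (𝓝 0) :=
      tendsto_const_div_atTop_nhds_zero_nat (2 * Real.pi) |>.comp (tendsto_add_atTop_nat 1)
        |>.congr fun n => by simp
    refine squeeze_zero (fun _ => dist_nonneg) (fun n => ?_) h0
    have hpi := Real.pi_pos
    rw [ContinuousMap.dist_le (by positivity)]
    intro k
    refine (Circle.dist_exp_one_le _).trans ?_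
    rw [abs_div, Nat.abs_cast]
    push_cast
    gcongr
    exact hb n k

/-- Stated for an abstract metric target: on `Circle` itself instance search does not identify the
topology with the one coming from the metric. -/
theorem ContinuousMap.baireSpace (K β : Type*) [TopologicalSpace K] [CompactSpace K]
    [MetricSpace β] [CompactSpace β] : BaireSpace C(K, β) :=
  inferInstance

/-- By Baire category, some (indeed a generic) continuous map from a compact, second countable,
totally disconnected space to the circle has its powers uniformly dense among all such maps.
The maps having a power in a given nonempty open set `V ∋ f` form an open set, and a dense one:
`φ * h` has `(n + 1)`-st power `f` when `h` is the small root of `f / φ ^ (n + 1)`. -/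
theorem exists_denseRange_zpow (K : Type*) [TopologicalSpace K] [CompactSpace K]
    [T2Space K] [TotallyDisconnectedSpace K] [SecondCountableTopology K] :
    ∃ φ : C(K, Circle), DenseRange fun n : ℤ => φ ^ n := by
  have hB : BaireSpace C(K, Circle) := ContinuousMap.baireSpace K Circle
  set b := TopologicalSpace.countableBasis C(K, Circle)
  have hb := TopologicalSpace.isBasis_countableBasis C(K, Circle)
  have hdense : Dense (⋂ V ∈ b, {φ : C(K, Circle) | ∃ n : ℤ, φ ^ n ∈ V}) := by
    refine dense_biInter_of_isOpen (fun V hV => ?_)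
      (TopologicalSpace.countable_countableBasis _) (fun V hV => ?_)
    · simp only [Set.ofPred_exists]
      exact isOpen_iUnion fun n => (hb.isOpen hV).preimage (continuous_zpow n)
    · obtain ⟨f, hf⟩ := TopologicalSpace.nonempty_of_mem_countableBasis hV
      intro φ
      obtain ⟨h, hh, hlim⟩ := ContinuousMap.exists_roots_tendsto_one
        (fun n => f / φ ^ (n + 1))
      have hlim' : Tendsto (fun n => φ * h n) atTop (𝓝 φ) := by
        simpa using hlim.const_mul φ
      refine mem_closure_of_tendsto hlim' (Eventually.of_forall fun n => ⟨(n + 1 : ℕ), ?_⟩)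
      rwa [zpow_natCast, mul_pow, hh, mul_div_cancel]
  obtain ⟨φ, hφ⟩ := hdense.nonempty
  refine ⟨φ, hb.dense_iff.2 fun V hV _ => ?_⟩
  obtain ⟨n, hn⟩ := Set.mem_iInter₂.1 hφ V hV
  exact ⟨_, hn, n, rfl⟩

/-! ### Kronecker Cantor sets as images of the Cantor space -/

/-- The continuous map on the Cantor space `ℕ → Bool` that takes the value `u` or `v` according
to the `i`-th coordinate. -/
def coordSwitch (i : ℕ) (u v : Circle) : C(ℕ → Bool, Circle) where
  toFun x := bif x i then u else v
  continuous_toFun :=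
    (continuous_of_discreteTopology (f := fun t : Bool => bif t then u else v)).comp
      (continuous_apply i)

theorem injective_of_denseRange_zpow {φ : C(ℕ → Bool, Circle)}
    (hφ : DenseRange fun n : ℤ => φ ^ n) : Function.Injective φ := by
  intro x y hxy
  have hall : ∀ f : C(ℕ → Bool, Circle), f x = f y := by
    intro f
    have hcl : IsClosed {f : C(ℕ → Bool, Circle) | f x = f y} :=
      isClosed_eq (continuous_eval_const x) (continuous_eval_const y)
    refine hφ.induction_on (p := fun f => f x = f y) f hcl fun n => ?_
    simp [hxy]
  by_contra hne
  obtain ⟨i, hi⟩ := Function.ne_iff.1 hne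
  have h := hall (coordSwitch i (-1) 1)
  have h1 : (-1 : Circle) ≠ 1 := Circle.neg_ne_self 1
  simp only [coordSwitch, ContinuousMap.coe_mk] at h
  cases hx : x i <;> cases hy : y i <;> rw [hx, hy] at h hi
  · exact hi rfl
  · exact h1 h.symm
  · exact h1 h
  · exact hi rfl

theorem accPt_cantorSpace (x : ℕ → Bool) : AccPt x (𝓟 Set.univ) := by
  have hlim : Tendsto (fun n => Function.update x n (!x n)) atTop (𝓝 x) := by
    rw [tendsto_pi_nhds]
    intro i
    refine tendsto_const_nhds.congr' ?_
    filter_upwards [eventually_gt_atTop i] with n hn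
    rw [Function.update_of_ne hn.ne]
  rw [accPt_iff_frequently]
  refine hlim.frequently (Frequently.of_forall fun n => ⟨fun h => ?_, trivial⟩)
  have := congrFun h n
  simp at this

theorem isCantorSet_range {φ : C(ℕ → Bool, Circle)} (hφ : Function.Injective φ) :
    IsCantorSet (Set.range φ) := by
  have hemb : IsEmbedding φ := (φ.continuous.isClosedEmbedding hφ).isEmbedding
  refine ⟨Set.range_nonempty _, isCompact_range φ.continuous,
    hemb.isTotallyDisconnected_range.2 inferInstance,
    (isCompact_range φ.continuous).isClosed, ?_⟩
  rintro _ ⟨x, rfl⟩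
  have h := (accPt_cantorSpace x).map φ.continuous.continuousAt hφ
  rwa [map_principal, Set.image_univ] at h

theorem isKroneckerSet_range {φ : C(ℕ → Bool, Circle)} (hφ : DenseRange fun n : ℤ => φ ^ n) :
    IsKroneckerSet (Set.range φ) := by
  intro f hf hf1 ε hε
  let g : C(ℕ → Bool, Circle) :=
    ⟨fun x => ⟨f (φ x), mem_sphere_zero_iff_norm.2 (hf1 _ ⟨x, rfl⟩)⟩,
      (hf.comp_continuous φ.continuous fun x => ⟨x, rfl⟩).subtype_mk _⟩
  obtain ⟨n, hn⟩ := hφ.exists_dist_lt g hε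
  refine ⟨n, ?_⟩
  rintro _ ⟨x, rfl⟩
  rw [← dist_eq_norm]
  exact (ContinuousMap.dist_apply_le_dist (f := g) (g := φ ^ n) x).trans_lt hn

/-! ### Fair coin tossing on the Cantor space -/

/-- The law of an infinite sequence of fair coin tosses. -/
noncomputable def coinMeasure : Measure (ℕ → Bool) :=
  Measure.infinitePi fun _ => (PMF.uniformOfFintype Bool).toMeasure

instance : IsProbabilityMeasure coinMeasure := by unfold coinMeasure; infer_instance

theorem coinMeasure_singleton (x : ℕ → Bool) : coinMeasure {x} = 0 := by
  have hle : ∀ n : ℕ, coinMeasure {x} ≤ 2⁻¹ ^ n := by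
    intro n
    refine (measure_mono (t := Set.pi (Finset.range n : Set ℕ) fun i => {x i}) ?_).trans_eq ?_
    · rintro _ rfl
      simp [Set.mem_pi]
    · rw [coinMeasure, Measure.infinitePi_pi _ fun i _ => measurableSet_singleton _]
      simp
  have hlim : Tendsto (fun n : ℕ => (2⁻¹ : ℝ≥0∞) ^ n) atTop (𝓝 0) :=
    ENNReal.tendsto_pow_atTop_nhds_zero_of_lt_one (by simp)
  exact le_antisymm (ge_of_tendsto' hlim hle) zero_le

theorem integral_coordSwitch (u v : Circle) :
    ∫ x, (coordSwitch 0 u v x : ℂ) ∂coinMeasure = ((u : ℂ) + v) / 2 := by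
  have h := measurePreserving_eval_infinitePi
    (fun _ : ℕ => (PMF.uniformOfFintype Bool).toMeasure) 0
  have h2 : ∫ x, (coordSwitch 0 u v x : ℂ) ∂coinMeasure =
      ∫ t, ((bif t then u else v : Circle) : ℂ) ∂(PMF.uniformOfFintype Bool).toMeasure := by
    conv_rhs => rw [← h.map_eq]
    rw [integral_map h.measurable.aemeasurable
      (measurable_of_countable _).aestronglyMeasurable]
    rfl
  rw [h2, PMF.integral_eq_sum]
  simp
  ring

/-- Every point of the closed unit disc is the midpoint of a chord of the circle. -/
theorem exists_circle_midpoint {c : ℂ} (hc : ‖c‖ ≤ 1) :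
    ∃ u v : Circle, ((u : ℂ) + v) / 2 = c := by
  -- The chord through `c = r e^{iα}` perpendicular to `e^{iα}` subtends the angles
  -- `α ± arccos r`.
  refine ⟨Circle.exp (Complex.arg c + Real.arccos ‖c‖),
    Circle.exp (Complex.arg c - Real.arccos ‖c‖), ?_⟩
  have hcos : Complex.cos (Real.arccos ‖c‖) = ‖c‖ := by
    rw [← Complex.ofReal_cos, Real.cos_arccos (by linarith [norm_nonneg c]) hc]
  conv_rhs => rw [← Complex.norm_mul_exp_arg_mul_I c, ← hcos]
  rw [Complex.cos]
  simp only [Circle.coe_exp, Complex.ofReal_add, Complex.ofReal_sub, add_mul, sub_mul,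
    Complex.exp_add, Complex.exp_sub, neg_mul, Complex.exp_neg]
  ring

/-! ### The coin-tossing measure on a Kronecker Cantor set -/

theorem coinMeasure_map_singleton {φ : C(ℕ → Bool, Circle)} (hφ : Function.Injective φ)
    (z : Circle) : coinMeasure.map φ {z} = 0 := by
  rw [Measure.map_apply φ.continuous.measurable (measurableSet_singleton z)]
  by_cases hz : ∃ x, φ x = z
  · obtain ⟨x, rfl⟩ := hz
    rw [← Set.image_singleton, hφ.preimage_image, coinMeasure_singleton]
  · convert measure_empty (μ := coinMeasure)
    ext x
    simpa using fun h => hz ⟨x, h⟩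

theorem coinMeasure_map_compl_range (φ : C(ℕ → Bool, Circle)) :
    coinMeasure.map φ (Set.range φ)ᶜ = 0 := by
  rw [Measure.map_apply φ.continuous.measurable
    (isCompact_range φ.continuous).isClosed.measurableSet.compl]
  simp

/-- The Fourier-Stieltjes coefficients are the integrals of the powers of `φ`; these approximate
a two-valued function on the Cantor space whose mean is any prescribed point of the disc. -/
theorem closedBall_subset_closure_range_integral_zpow {φ : C(ℕ → Bool, Circle)}
    (hφ : DenseRange fun n : ℤ => φ ^ n) :
    Metric.closedBall 0 1 ⊆
      closure (Set.range fun n : ℤ => ∫ y : Circle, (y : ℂ) ^ n ∂coinMeasure.map φ) := by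
  intro c hc
  rw [mem_closedBall_zero_iff] at hc
  obtain ⟨u, v, rfl⟩ := exists_circle_midpoint hc
  rw [← integral_coordSwitch, Metric.mem_closure_range_iff]
  intro ε hε
  obtain ⟨n, hn⟩ := hφ.exists_dist_lt (coordSwitch 0 u v) (half_pos hε)
  have hco : Continuous fun z : Circle => (z : ℂ) := continuous_subtype_val
  have hint : ∀ f : C(ℕ → Bool, Circle), Integrable (fun x => (f x : ℂ)) coinMeasure := fun f =>
    Integrable.of_bound (hco.comp f.continuous).aestronglyMeasurable 1
      (Eventually.of_forall fun x => (Circle.norm_coe _).le)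
  have hmap : ∫ y : Circle, (y : ℂ) ^ n ∂coinMeasure.map φ =
      ∫ x, ((φ ^ n) x : ℂ) ∂coinMeasure := by
    rw [integral_map φ.continuous.measurable.aemeasurable
      (Circle.continuous_coe_zpow n).aestronglyMeasurable]
    simp
  refine ⟨n, ?_⟩
  rw [hmap, dist_eq_norm, ← integral_sub (hint _) (hint _)]
  refine (norm_integral_le_of_norm_le_const (C := ε / 2) (Eventually.of_forall fun x => ?_)).trans_lt
    ?_
  · rw [← dist_eq_norm]
    exact (ContinuousMap.dist_apply_le_dist (f := coordSwitch 0 u v) (g := φ ^ n) x).trans hn.le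
  · simpa using half_lt_self hε

/-! ### Existence of the measure -/

theorem mainTheorem10 :
    ∃ (μ : Measure Circle) (_ : IsProbabilityMeasure μ),
      (∀ z : Circle, μ {z} = 0) ∧
      (∃ C : Set Circle, IsCantorSet C ∧ IsKroneckerSet C ∧ μ Cᶜ = 0) ∧
      (∀ k : ℕ, 1 ≤ k → (convPow μ k).MutuallySingular circleMeasure) ∧
      (∀ (p : ℝ≥0∞) [Fact (1 ≤ p)], ∃ c : ℝ, 0 < c ∧
        Tendsto (fun n : ℕ => ‖convOp μ p ^ n - meanOp p‖) atTop (𝓝 c)) ∧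
      spectrum ℂ (convOp μ 1) = spectrum ℂ (convOp μ 2) ∧
      spectrum ℂ (convOp μ 2) = Metric.closedBall (0 : ℂ) 1 := by
  obtain ⟨φ, hφ⟩ := exists_denseRange_zpow (ℕ → Bool)
  have hinj := injective_of_denseRange_zpow hφ
  have hK := isKroneckerSet_range hφ
  have hC := coinMeasure_map_compl_range φ
  have hprob : IsProbabilityMeasure (coinMeasure.map φ) :=
    Measure.isProbabilityMeasure_map φ.continuous.measurable.aemeasurable
  have hcoeff := closedBall_subset_closure_range_integral_zpow hφ
  refine ⟨coinMeasure.map φ, hprob, coinMeasure_map_singleton hinj,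
    ⟨Set.range φ, isCantorSet_range hinj, hK, hC⟩,
    fun k _ => hK.convPow_mutuallySingular hC k,
    fun p _ => exists_tendsto_norm_convOp_pow_sub _ p (hcoeff (by simp)), ?_,
    spectrum_convOp_eq_closedBall _ 2 hcoeff⟩
  rw [spectrum_convOp_eq_closedBall _ 1 hcoeff, spectrum_convOp_eq_closedBall _ 2 hcoeff]
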